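/- Let $G$ be a Carnot group of step $s\ge 1$, with stratified Lie algebra $\mathfrak g=V_1\oplus\cdots\oplus V_s$ ($V_i\neq\{0\}$, $[V_1,V_i]=V_{i+1}$ for $1\le i<s$, and $[V_1,V_s]=\{0\}$), and put $n_i=\dim V_i$, $n=n_1+\cdots+n_s$. Using exponential coordinates relative to a basis of $\mathfrak g$ adapted to the stratification, identify $G$ with $\mathbb R^n=\mathbb R^{n_1}\times\cdots\times\mathbb R^{n_s}$, write $x=(x_1,\dots,x_s)$ with $x_i\in\mathbb R^{n_i}$, let $|\cdot|$ denote Euclidean norms, let $B_{\mathbb R^n}(\rho)$ be the closed Euclidean ball of radius $\rho$ about $0$, and let $\delta_r(x)=(r x_1,r^2x_2,\dots,r^sx_s)$ for $r>0$. Let $\eta>0$ be such that $$N(g)=N_\eta(g)=\inf\{r>0 : g\in\delta_r(B_{\mathbb R^n}(\eta))\}$$ is a homogeneous norm on $G$, that is, for all $g,h\in G$ and $t>0$: $N(g)\ge 0$; $N(g)=0$ if and only if $g=0$; $N(g^{-1})=N(g)$; $N(gh)\le N(g)+N(h)$; and $N(\delta_t(g))=tN(g)$ (a Hebisch–Sikora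 norm). Let $d(g,h)=N(g^{-1}h)$ be the associated left-invariant metric. Let $\pi:G\to\mathbb R^{n_1}$, $\pi(x)=x_1$, be the projection to the first layer, and equip $\mathbb R^{n_1}$ with the norm induced by $N$, $|v|_1:=N(v,0,\dots,0)=|v|/\eta$ (which is the Euclidean norm when $\eta=1$). A horizontal line is a set $L=x\cdot\{(tv,0,\dots,0):t\in\mathbb R\}$ with $x\in G$ and $0\ne v\in\mathbb R^{n_1}$. Then for every $\alpha>1$ there exist constants $C>0$ and $\varepsilon_0>0$, depending only on $G$ (with its coordinates and metric) and $\alpha$, such that the following holds. Let $L\subset G$ be a horizontal line, let $P:G\to\pi(L)$ be the composition of $\pi$ with the orthogonal projection of $\mathbb R^{n_1}$ onto the affine line $\pi(L)$, let $0\le\varepsilon<\varepsilon_0$, and let $a,b\in L\cdot B_{\mathbb R^n}(\varepsilon^s)$ with $d(a,b)\in[1,\alpha]$. Then $$\frac{d(a,b)}{1+C\varepsilon^{2s}}\ \le\ |P(a)-P(b)|_1\ \le\ d(a,b).$$ -/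

import Mathlib

open scoped Manifold ContDiff

noncomputable section

namespace Carnot

/-- The underlying manifold `ℝ^{n₁} × ⋯ × ℝ^{n_s}` of a step `s` Carnot group in exponential
coordinates, with its Euclidean norm. The layers are indexed from `0`, so that `x i` is the
component of `x` in the layer `V_{i+1}`, of dimension `n i`. -/
abbrev Coord {s : ℕ} (n : Fin s → ℕ) : Type :=
  PiLp 2 (fun i : Fin s => EuclideanSpace ℝ (Fin (n i)))

/-- The layer `V_{i+1}`, as a subspace of the coordinate space (which is also the Lie algebra);
it is zero for `i ≥ s`. -/
def layer {s : ℕ} (n : Fin s → ℕ) (i : ℕ) : Submodule ℝ (Coord n) where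
  carrier := {x | ∀ j : Fin s, (j : ℕ) ≠ i → x j = 0}
  add_mem' := by
    intro x y hx hy j hj
    simp [hx j hj, hy j hj]
  zero_mem' := by
    intro j _
    simp
  smul_mem' := by
    intro c x hx j hj
    simp [hx j hj]

/-- The Lie bracket of the Lie algebra (the tangent space at the identity, with the bracket of
left-invariant vector fields) of a Lie group whose underlying manifold is `Coord n`. -/
def lieBracket {s : ℕ} {n : Fin s → ℕ} [Group (Coord n)] (X Y : Coord n) : Coord n :=
  Bracket.bracket (L := GroupLieAlgebra 𝓘(ℝ, Coord n) (Coord n))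
    (M := GroupLieAlgebra 𝓘(ℝ, Coord n) (Coord n)) X Y

end Carnot

open Carnot in
/-- A Carnot group of step `s` in exponential coordinates: a Lie group with underlying manifold
`ℝ^{n₁} × ⋯ × ℝ^{n_s}`, whose exponential map is the identity (the one-parameter subgroup with
initial velocity `X` is `t ↦ t X`) and whose Lie algebra is stratified by the coordinate layers
`V_1, …, V_s`. -/
structure CarnotGroup {s : ℕ} (n : Fin s → ℕ) extends Group (Coord n) where
  /-- the group operations are smooth -/
  lieGroup : LieGroup 𝓘(ℝ, Coord n) ∞ (Coord n)
  /-- the coordinates are exponential coordinates -/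
  exp_coord : ∀ (X : Coord n) (t u : ℝ), (t • X) * (u • X) = (t + u) • X
  /-- the layers are nonzero -/
  dim_pos : ∀ i, 0 < n i
  /-- `[V_1, V_i] = V_{i+1}` for `i < s`, and `[V_1, V_s] = 0` (the layer of index `s` is zero) -/
  stratified : ∀ i < s,
    Submodule.span ℝ {Z | ∃ X ∈ layer n 0, ∃ Y ∈ layer n i, Z = lieBracket X Y} = layer n (i + 1)

namespace CarnotGroup

open Carnot

/-- The dilation `δ_t(x₁, …, x_s) = (t x₁, t² x₂, …, t^s x_s)`. -/
def dilation {s : ℕ} {n : Fin s → ℕ} (t : ℝ) (x : Coord n) : Coord n :=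
  WithLp.toLp 2 (fun i => t ^ ((i : ℕ) + 1) • x i)

/-- The Minkowski gauge `N_η(g) = inf {r > 0 : g ∈ δ_r(B(η))}`, with `B(η)` the Euclidean ball of
radius `η` about the origin. -/
def gauge {s : ℕ} {n : Fin s → ℕ} (η : ℝ) (g : Coord n) : ℝ :=
  sInf {r : ℝ | 0 < r ∧ g ∈ dilation r '' Metric.closedBall (0 : Coord n) η}

/-- Homogeneous norms on a Carnot group. -/
structure IsHomogeneousNorm {s : ℕ} {n : Fin s → ℕ} (G : CarnotGroup n) (N : Coord n → ℝ) :
    Prop where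
  nonneg : ∀ g, 0 ≤ N g
  eq_zero_iff : ∀ g, N g = 0 ↔ g = 0
  inv : ∀ g, N (G.inv g) = N g
  mul_le : ∀ g h, N (G.mul g h) ≤ N g + N h
  dilation : ∀ t : ℝ, 0 < t → ∀ g, N (dilation t g) = t * N g

/-- `η > 0` is the parameter of a Hebisch-Sikora norm on `G`: the gauge `N_η` is a homogeneous
norm. -/
def IsHebischSikora {s : ℕ} {n : Fin s → ℕ} (G : CarnotGroup n) (η : ℝ) : Prop :=
  0 < η ∧ G.IsHomogeneousNorm (gauge η)

/-- The left-invariant metric `d(a, b) = N_η(a⁻¹ b)`. -/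
def metric {s : ℕ} {n : Fin s → ℕ} (G : CarnotGroup n) (η : ℝ) (a b : Coord n) : ℝ :=
  gauge η (G.mul (G.inv a) b)

/-- The projection `π` onto the first layer. -/
def proj {s : ℕ} [NeZero s] {n : Fin s → ℕ} (x : Coord n) : EuclideanSpace ℝ (Fin (n 0)) :=
  x 0

/-- The point `(v, 0, …, 0)`. -/
def horizontal {s : ℕ} [NeZero s] {n : Fin s → ℕ} (v : EuclideanSpace ℝ (Fin (n 0))) : Coord n :=
  PiLp.single 2 0 v

/-- The set `x · {(t v, 0, …, 0) : t ∈ ℝ}`, which is a horizontal line if `v ≠ 0`. -/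
def horizontalLine {s : ℕ} [NeZero s] {n : Fin s → ℕ} (G : CarnotGroup n) (x : Coord n)
    (v : EuclideanSpace ℝ (Fin (n 0))) : Set (Coord n) :=
  Set.range (fun t : ℝ => G.mul x (horizontal (t • v)))

/-- A set is a horizontal line. -/
def IsHorizontalLine {s : ℕ} [NeZero s] {n : Fin s → ℕ} (G : CarnotGroup n)
    (L : Set (Coord n)) : Prop :=
  ∃ (x : Coord n) (v : EuclideanSpace ℝ (Fin (n 0))), v ≠ 0 ∧ L = G.horizontalLine x v

/-- The tubular neighborhood `L · B(ρ)`, with `B(ρ)` the closed Euclidean ball of radius `ρ` about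
the origin. -/
def tube {s : ℕ} {n : Fin s → ℕ} (G : CarnotGroup n) (L : Set (Coord n)) (ρ : ℝ) :
    Set (Coord n) :=
  {a | ∃ l ∈ L, ∃ p ∈ Metric.closedBall (0 : Coord n) ρ, a = G.mul l p}

/-- For a horizontal line `L`, the composition of `π` with the orthogonal projection onto `π(L)`.
The set `π(L)` is an affine line, so that it is equal to its affine span. -/
def lineProj {s : ℕ} [NeZero s] {n : Fin s → ℕ} (L : Set (Coord n)) [Nonempty L] (x : Coord n) :
    EuclideanSpace ℝ (Fin (n 0)) :=
  EuclideanGeometry.orthogonalProjection (affineSpan ℝ (proj '' L)) (proj x)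

end CarnotGroup

end

/-!
Left translation reduces the distance of two points `a = l p` and `b = l' q`, with `l, l'` on the
line and `p, q` of Euclidean size at most `ε ^ s`, to the gauge of `w = a⁻¹ b = p⁻¹ m q`, where the
horizontal vector `m = l⁻¹ l'` is parallel to the line. Two facts about the group law suffice.

* The projection `π` onto the first layer is a homomorphism (`CarnotGroup.proj_mul`). Hence
  `π(w) = π(b) - π(a)`, and `|P(a) - P(b)|` is the length `c` of the component of `π(w)` along the
  line. To see it from the Lie algebra alone, without the Baker-Campbell-Hausdorff formula, take the
  left-invariant 1-form `ω` with value `π` at the identity. The stratification forces all brackets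
  into `ker π`, so `ω` is closed; in exponential coordinates `ω_x(x) = π(x)`, so integrating along
  rays shows that `ω` is the constant form `dπ`
  (`LieGroupOnVectorSpace.invariantForm_eq`). Left invariance of `ω` is then additivity of `π`.
* The group operations are locally Lipschitz, so `‖w - m‖ = O(ε ^ s)` uniformly
  (`CarnotGroup.exists_norm_conj_sub_le`).

The upper bound holds as the gauge of `w` dominates `‖π(w)‖ / η`. For the lower bound, split
`w` into its component of length `c` along the line and a perpendicular remainder of size
`O(ε ^ s)`. In the squared Euclidean norm of a dilate of `w` the remainder contributes only
`O(ε ^ (2 s))`, so `w` lies in the dilate of the `η`-ball by `(1 + O(ε ^ (2 s))) c / η`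
(`CarnotGroup.gauge_le_of_near_horizontal`).
-/

/-! ### Left-invariant forms in exponential coordinates -/

namespace LieGroupOnVectorSpace

variable {E F : Type*} [NormedAddCommGroup E] [NormedSpace ℝ E] [Group E]
  [NormedAddCommGroup F] [NormedSpace ℝ F]

/-- The left-invariant `F`-valued 1-form on `E` whose value at the identity is `A`. It is defined
through the derivative of `h ↦ g⁻¹ * h` at `g`, rather than the inverse of that of `h ↦ g * h`. -/
noncomputable def invariantForm (A : E →L[ℝ] F) (g : E) : E →L[ℝ] F :=
  A ∘L fderiv ℝ (fun h : E => g⁻¹ * h) g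

/-- The left-invariant vector field with value `X` at the identity, as a function `E → E`: all the
tangent spaces are identified with `E`. -/
noncomputable def leftInvariantField (X : E) (g : E) : E :=
  fderiv ℝ (fun h : E => g * h) 1 X

/-- The bracket of the Lie algebra `T₁E`, identified with `E`. It is `Carnot.lieBracket` when `E`
is the coordinate space of a Carnot group. -/
noncomputable def bracketAtOne (X Y : E) : E :=
  Bracket.bracket (L := GroupLieAlgebra 𝓘(ℝ, E) E) (M := GroupLieAlgebra 𝓘(ℝ, E) E) X Y

theorem one_eq_zero (hexp : ∀ (X : E) (t u : ℝ), (t • X) * (u • X) = (t + u) • X) :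
    (1 : E) = 0 := by
  have h := hexp 0 0 0
  simp only [smul_zero] at h
  exact (mul_eq_left.mp h).symm

theorem inv_eq_neg (hexp : ∀ (X : E) (t u : ℝ), (t • X) * (u • X) = (t + u) • X) (x : E) :
    x⁻¹ = -x := by
  refine inv_eq_of_mul_eq_one_left ?_
  have h := hexp x (-1) 1
  rw [one_smul, neg_one_smul, neg_add_cancel, zero_smul] at h
  rw [h, one_eq_zero hexp]

theorem invariantForm_one (A : E →L[ℝ] F) : invariantForm A 1 = A := by
  unfold invariantForm
  simp only [inv_one, one_mul]
  rw [show (fun h : E => h) = id from rfl, fderiv_id]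
  simp

variable [LieGroup 𝓘(ℝ, E) ∞ E]

/-- Smoothness in the form in which Mathlib's Lie algebra of a Lie group asks for it. -/
theorem lieGroup_minSmoothness : LieGroup 𝓘(ℝ, E) (minSmoothness ℝ 3) E := by
  rw [minSmoothness_of_isRCLikeNormedField]
  infer_instance

theorem contDiff_groupMul : ContDiff ℝ ∞ (fun p : E × E => p.1 * p.2) := by
  have h := _root_.contMDiff_mul (G := E) 𝓘(ℝ, E) ∞
  rw [← modelWithCornersSelf_prod, chartedSpaceSelf_prod] at h
  exact h.contDiff

theorem contDiff_groupInv : ContDiff ℝ ∞ (fun g : E => g⁻¹) :=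
  (_root_.contMDiff_inv (G := E) 𝓘(ℝ, E) ∞).contDiff

theorem differentiable_mul_left (g : E) : Differentiable ℝ (fun h : E => g * h) :=
  ((contDiff_groupMul (E := E)).comp (contDiff_const.prodMk contDiff_id)).differentiable (by simp)

theorem contDiff_invariantForm (A : E →L[ℝ] F) : ContDiff ℝ ∞ (invariantForm A) := by
  have h : ContDiff ℝ ∞ (fun g : E => fderiv ℝ (fun h : E => g⁻¹ * h) g) := by
    refine ContDiff.fderiv (m := ∞) (n := ∞) (f := fun g h : E => g⁻¹ * h) ?_ contDiff_id (by simp)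
    exact contDiff_groupMul.comp ((contDiff_groupInv.comp contDiff_fst).prodMk contDiff_snd)
  exact contDiff_const.clm_comp h

theorem invariantForm_mul_left (A : E →L[ℝ] F) (g h : E) :
    invariantForm A (g * h) ∘L fderiv ℝ (fun k : E => g * k) h = invariantForm A h := by
  have hc : (fun k : E => (g * h)⁻¹ * k) ∘ (fun k : E => g * k) = fun k => h⁻¹ * k := by
    ext1 k
    simp [mul_assoc]
  unfold invariantForm
  rw [ContinuousLinearMap.comp_assoc,
    ← fderiv_comp h (differentiable_mul_left _ _) (differentiable_mul_left _ _), hc]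

theorem invariantForm_leftInvariantField (A : E →L[ℝ] F) (X g : E) :
    invariantForm A g (leftInvariantField X g) = A X := by
  have h := congrArg (fun B => B X) (invariantForm_mul_left A g 1)
  simp only [mul_one, invariantForm_one] at h
  exact h

theorem exists_leftInvariantField_eq (g Y : E) : ∃ X : E, leftInvariantField X g = Y := by
  refine ⟨fderiv ℝ (fun h : E => g⁻¹ * h) g Y, ?_⟩
  have hc : (fun k : E => g * k) ∘ (fun k : E => g⁻¹ * k) = id := by
    ext1 k
    simp
  have h : fderiv ℝ ((fun k : E => g * k) ∘ (fun k : E => g⁻¹ * k)) g =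
      fderiv ℝ (fun k : E => g * k) 1 ∘L fderiv ℝ (fun k : E => g⁻¹ * k) g := by
    rw [fderiv_comp g (differentiable_mul_left _ _) (differentiable_mul_left _ _)]
    simp
  rw [hc, fderiv_id] at h
  exact (congrArg (fun B => B Y) h).symm

theorem differentiable_leftInvariantField (X : E) :
    Differentiable ℝ (leftInvariantField X) := by
  have h : ContDiff ℝ ∞ (fun g : E => fderiv ℝ (fun h : E => g * h) 1 X) := by
    refine ContDiff.clm_apply ?_ contDiff_const
    exact ContDiff.fderiv (m := ∞) (n := ∞) (f := fun g h : E => g * h) contDiff_groupMul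
      contDiff_const (by simp)
  exact h.differentiable (by simp)

/-- In exponential coordinates the velocity of the one-parameter group `t ↦ t • x` is everywhere
the left-invariant field with value `x` at the identity, so that the left-invariant form takes the
value `A x` on it. -/
theorem invariantForm_self (hexp : ∀ (X : E) (t u : ℝ), (t • X) * (u • X) = (t + u) • X)
    (A : E →L[ℝ] F) (x : E) : invariantForm A x x = A x := by
  have h1 : HasDerivAt (fun t : ℝ => x⁻¹ * (t • x)) (fderiv ℝ (fun h : E => x⁻¹ * h) x x) 1 := by
    have h2 : HasDerivAt (fun t : ℝ => t • x) x 1 := by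
      simpa using (hasDerivAt_id (1 : ℝ)).smul_const x
    have h3 : HasFDerivAt (fun h : E => x⁻¹ * h) (fderiv ℝ (fun h : E => x⁻¹ * h) x)
        ((1 : ℝ) • x) := by
      rw [one_smul]
      exact (differentiable_mul_left _ _).hasFDerivAt
    exact h3.comp_hasDerivAt (1 : ℝ) h2
  have h4 : HasDerivAt (fun t : ℝ => x⁻¹ * (t • x)) x 1 := by
    have : (fun t : ℝ => x⁻¹ * (t • x)) = fun t => (-1 + t) • x := by
      ext1 t
      rw [inv_eq_neg hexp, ← neg_one_smul ℝ x, hexp]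
    rw [this]
    simpa using ((hasDerivAt_id (1 : ℝ)).const_add (-1)).smul_const x
  exact congrArg A (h1.unique h4)

variable [CompleteSpace E]

theorem lieBracket_leftInvariantField (X Y : E) :
    VectorField.lieBracket ℝ (leftInvariantField X) (leftInvariantField Y) =
      leftInvariantField (bracketAtOne X Y) := by
  have := lieGroup_minSmoothness (E := E)
  have hf : ∀ Z : GroupLieAlgebra 𝓘(ℝ, E) E,
      mulInvariantVectorField (I := 𝓘(ℝ, E)) (G := E) Z = leftInvariantField (E := E) Z := by
    intro Z
    ext1 g
    exact congrArg (fun B : E →L[ℝ] E => B Z) mfderiv_eq_fderiv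
  have h : ∀ X Y : GroupLieAlgebra 𝓘(ℝ, E) E, leftInvariantField (bracketAtOne (E := E) X Y) =
      VectorField.mlieBracket 𝓘(ℝ, E) (leftInvariantField (E := E) X)
        (leftInvariantField (E := E) Y) := by
    intro X Y
    have h := mulInvariantVector_mlieBracket (I := 𝓘(ℝ, E)) (G := E) X Y
    rw [← GroupLieAlgebra.bracket_def, hf, hf, hf] at h
    exact h
  have h' := VectorField.mlieBracketWithin_eq_lieBracketWithin (𝕜 := ℝ) (E := E)
    (V := leftInvariantField X) (W := leftInvariantField Y) (s := Set.univ)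
  rw [VectorField.lieBracketWithin_univ] at h'
  exact h'.symm.trans (h X Y).symm

theorem bracketAtOne_add_right (X Y Z : E) :
    bracketAtOne X (Y + Z) = bracketAtOne X Y + bracketAtOne X Z := by
  have := lieGroup_minSmoothness (E := E)
  exact lie_add (L := GroupLieAlgebra 𝓘(ℝ, E) E) (M := GroupLieAlgebra 𝓘(ℝ, E) E) X Y Z

theorem bracketAtOne_smul_right (c : ℝ) (X Y : E) :
    bracketAtOne X (c • Y) = c • bracketAtOne X Y := by
  have := lieGroup_minSmoothness (E := E)
  exact lie_smul (L := GroupLieAlgebra 𝓘(ℝ, E) E) (M := GroupLieAlgebra 𝓘(ℝ, E) E) c X Y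

theorem bracketAtOne_swap (X Y : E) : bracketAtOne X Y = -bracketAtOne Y X := by
  have := lieGroup_minSmoothness (E := E)
  exact (lie_skew (L := GroupLieAlgebra 𝓘(ℝ, E) E) X Y).symm

theorem bracketAtOne_bracketAtOne (X Y Z : E) :
    bracketAtOne (bracketAtOne X Y) Z =
      bracketAtOne X (bracketAtOne Y Z) - bracketAtOne Y (bracketAtOne X Z) := by
  have := lieGroup_minSmoothness (E := E)
  exact lie_lie (L := GroupLieAlgebra 𝓘(ℝ, E) E) (M := GroupLieAlgebra 𝓘(ℝ, E) E) X Y Z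

/-- A left-invariant form that vanishes on brackets is closed. Evaluated on left-invariant fields
it is constant, and differentiating this relation gives `dω(X, Y) = -ω([X, Y])`. -/
theorem fderiv_invariantForm_symm (A : E →L[ℝ] F) (hA : ∀ X Y : E, A (bracketAtOne X Y) = 0)
    (g U V : E) :
    fderiv ℝ (invariantForm A) g U V = fderiv ℝ (invariantForm A) g V U := by
  obtain ⟨X, rfl⟩ := exists_leftInvariantField_eq g U
  obtain ⟨Y, rfl⟩ := exists_leftInvariantField_eq g V
  have hω : DifferentiableAt ℝ (invariantForm A) g :=
    (contDiff_invariantForm A).differentiable (by simp) g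
  have key : ∀ X Z : E, fderiv ℝ (invariantForm A) g Z (leftInvariantField X g) +
      invariantForm A g (fderiv ℝ (leftInvariantField X) g Z) = 0 := by
    intro X Z
    have h1 : fderiv ℝ (fun y => invariantForm A y (leftInvariantField X y)) g = 0 := by
      rw [show (fun y => invariantForm A y (leftInvariantField X y)) = fun _ => A X from
        funext fun y => invariantForm_leftInvariantField A X y, fderiv_fun_const]
      rfl
    rw [fderiv_clm_apply hω (differentiable_leftInvariantField X g)] at h1
    have h2 := congrArg (fun B => B Z) h1
    simpa [add_comm] using h2
  have h3 := congrArg (invariantForm A g) (congrFun (lieBracket_leftInvariantField X Y) g)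
  rw [invariantForm_leftInvariantField, hA, VectorField.lieBracket_eq, map_sub,
    sub_eq_zero] at h3
  rw [eq_neg_of_add_eq_zero_left (key X _), eq_neg_of_add_eq_zero_left (key Y _), h3]

/-- In exponential coordinates a left-invariant form that vanishes on brackets is constant. As in
the Poincaré lemma one looks at `t • ω_{t x}(v)`: by closedness and the derivative of
`ω_y(y) = A y` in the direction `v`, its derivative in `t` is `A v`. -/
theorem invariantForm_eq (hexp : ∀ (X : E) (t u : ℝ), (t • X) * (u • X) = (t + u) • X)
    (A : E →L[ℝ] F) (hA : ∀ X Y : E, A (bracketAtOne X Y) = 0) (x : E) : invariantForm A x = A := by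
  ext v
  have hω : Differentiable ℝ (invariantForm A) :=
    (contDiff_invariantForm A).differentiable (by simp)
  have hrad : ∀ y, fderiv ℝ (invariantForm A) y v y + invariantForm A y v = A v := by
    intro y
    have h1 : fderiv ℝ (fun y => invariantForm A y y) y = A := by
      rw [show (fun y => invariantForm A y y) = A from funext (invariantForm_self hexp A)]
      exact A.fderiv
    rw [fderiv_clm_apply (hω y) differentiableAt_fun_id] at h1
    have h2 := congrArg (fun B => B v) h1
    simpa [add_comm] using h2
  have hder : ∀ t : ℝ, HasDerivAt (fun t : ℝ => t • invariantForm A (t • x) v - t • A v) 0 t := by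
    intro t
    have h1 : HasDerivAt (fun t : ℝ => t • x) x t := by
      simpa using (hasDerivAt_id t).smul_const x
    have h2 : HasDerivAt (fun t : ℝ => invariantForm A (t • x) v)
        (fderiv ℝ (invariantForm A) (t • x) x v) t := by
      have h := (hω (t • x)).hasFDerivAt.comp_hasDerivAt t h1
      exact ((ContinuousLinearMap.apply ℝ F v).hasFDerivAt.comp_hasDerivAt t h)
    refine (((hasDerivAt_id t).smul h2).sub ((hasDerivAt_id t).smul_const (A v))).congr_deriv ?_
    have h3 := hrad (t • x)
    rw [map_smul, fderiv_invariantForm_symm A hA] at h3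
    simp only [id, one_smul]
    rw [h3, sub_self]
  have h := is_const_of_deriv_eq_zero (fun t => (hder t).differentiableAt)
    (fun t => (hder t).deriv) 1 0
  simpa [sub_eq_zero] using h

/-- In exponential coordinates a linear map that vanishes on brackets is a group homomorphism. Its
derivative is the left-invariant form `ω`, hence `h ↦ A (g * h) - A h` is constant. -/
theorem map_mul_eq_add (hexp : ∀ (X : E) (t u : ℝ), (t • X) * (u • X) = (t + u) • X)
    (A : E →L[ℝ] F) (hA : ∀ X Y : E, A (bracketAtOne X Y) = 0) (g h : E) :
    A (g * h) = A g + A h := by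
  have hder : ∀ k : E, HasFDerivAt (fun k => A (g * k) - A k) (0 : E →L[ℝ] F) k := by
    intro k
    have h1 := invariantForm_mul_left A g k
    rw [invariantForm_eq hexp A hA, invariantForm_eq hexp A hA] at h1
    have h2 := (A.hasFDerivAt (x := g * k)).comp k (differentiable_mul_left g k).hasFDerivAt
    rw [h1] at h2
    exact (h2.sub (A.hasFDerivAt (x := k))).congr_fderiv (sub_self A)
  have h3 := is_const_of_fderiv_eq_zero (𝕜 := ℝ) (fun k => (hder k).differentiableAt)
    (fun k => (hder k).fderiv) h 1
  simp only [mul_one] at h3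
  rw [one_eq_zero hexp, map_zero, sub_zero] at h3
  exact sub_eq_iff_eq_add.mp h3

end LieGroupOnVectorSpace

/-! ### The projection onto the first layer is a homomorphism -/

namespace CarnotGroup

open Carnot LieGroupOnVectorSpace

variable {s : ℕ} {n : Fin s → ℕ}

theorem eq_zero_of_mem_layer {i : ℕ} (hi : s ≤ i) {X : Coord n} (hX : X ∈ layer n i) : X = 0 := by
  ext1 j
  exact hX j (by omega)

/-- `[V_{i+1}, V_{j+1}] ⊆ V_{i+j+2}`, by induction on `i` from the stratification and the Jacobi
identity. -/
theorem bracketAtOne_mem_layer (G : CarnotGroup n) (i j : ℕ) :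
    letI := G.toGroup
    ∀ X ∈ layer n i, ∀ Y ∈ layer n j, bracketAtOne X Y ∈ layer n (i + j + 1) := by
  let := G.toGroup
  have := G.lieGroup
  have hzero : ∀ Y : Coord n, bracketAtOne Y 0 = 0 := fun Y => by
    simpa using bracketAtOne_smul_right 0 Y 0
  have hzero' : ∀ Y : Coord n, bracketAtOne 0 Y = 0 := fun Y => by
    rw [bracketAtOne_swap, hzero, neg_zero]
  induction i generalizing j with
  | zero =>
    intro X hX Y hY
    rcases lt_or_ge j s with hj | hj
    · rw [zero_add, ← G.stratified j hj]
      exact Submodule.subset_span ⟨X, hX, Y, hY, rfl⟩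
    · rw [eq_zero_of_mem_layer hj hY, hzero]
      exact zero_mem _
  | succ i ih =>
    intro X hX Y hY
    rcases lt_or_ge i s with hi | hi
    · rw [← G.stratified i hi] at hX
      induction hX using Submodule.span_induction with
      | mem Z hZ =>
        obtain ⟨V, hV, W, hW, rfl⟩ := hZ
        change bracketAtOne (bracketAtOne V W) Y ∈ _
        rw [bracketAtOne_bracketAtOne]
        have hone : ∀ k, ∀ Z ∈ layer n k, bracketAtOne V Z ∈ layer n (k + 1) := by
          intro k Z hZ
          rcases lt_or_ge k s with hk | hk
          · rw [← G.stratified k hk]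
            exact Submodule.subset_span ⟨V, hV, Z, hZ, rfl⟩
          · rw [eq_zero_of_mem_layer hk hZ, hzero]
            exact zero_mem _
        have h1 := hone _ _ (ih j W hW Y hY)
        have h2 := ih _ W hW _ (hone _ _ hY)
        rw [show i + 1 + j + 1 = i + j + 1 + 1 by omega]
        exact sub_mem h1 h2
      | zero =>
        rw [hzero']
        exact zero_mem _
      | add U V _ _ hU hV =>
        rw [bracketAtOne_swap, bracketAtOne_add_right, neg_add, ← bracketAtOne_swap,
          ← bracketAtOne_swap]
        exact add_mem hU hV
      | smul c U _ hU =>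
        rw [bracketAtOne_swap, bracketAtOne_smul_right, ← smul_neg, ← bracketAtOne_swap]
        exact Submodule.smul_mem _ c hU
    · rw [eq_zero_of_mem_layer (by omega) hX, hzero']
      exact zero_mem _

theorem eq_sum_single (X : Coord n) : X = ∑ i, PiLp.single 2 i (X i) := by
  ext1 j
  rw [WithLp.ofLp_sum, Finset.sum_apply, Finset.sum_eq_single j]
  · simp
  · intro i _ hij
    rw [PiLp.single_eq_of_ne 2 (Ne.symm hij)]
  · simp

theorem single_mem_layer (i : Fin s) (v : EuclideanSpace ℝ (Fin (n i))) :
    (PiLp.single 2 i v : Coord n) ∈ layer n i := by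
  intro j hj
  have hji : j ≠ i := fun h => hj (by rw [h])
  rw [PiLp.single_eq_of_ne 2 hji]

variable [NeZero s]

/-- All brackets lie in the kernel of the projection onto the first layer. -/
theorem bracketAtOne_apply_zero (G : CarnotGroup n) (X Y : Coord n) :
    letI := G.toGroup
    (bracketAtOne X Y) 0 = 0 := by
  let := G.toGroup
  have := G.lieGroup
  have hright : ∀ X : Coord n, (∀ (i : Fin s) (v : EuclideanSpace ℝ (Fin (n i))),
      (bracketAtOne X (PiLp.single 2 i v)) 0 = 0) → ∀ Y, (bracketAtOne X Y) 0 = 0 := by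
    intro X h Y
    rw [eq_sum_single Y]
    refine Finset.sum_induction _ (fun Y : Coord n => (bracketAtOne X Y) 0 = 0) ?_ ?_
      fun i _ => h i _
    · intro U V hU hV
      rw [bracketAtOne_add_right, PiLp.add_apply, hU, hV, add_zero]
    · have := bracketAtOne_smul_right 0 X (0 : Coord n)
      rw [zero_smul, zero_smul] at this
      rw [this]
      rfl
  refine hright X (fun i v => ?_) Y
  rw [bracketAtOne_swap, PiLp.neg_apply, neg_eq_zero]
  refine hright _ (fun j u => ?_) X
  exact bracketAtOne_mem_layer G i j _ (single_mem_layer i v) _ (single_mem_layer j u) 0 (by simp)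

theorem proj_mul (G : CarnotGroup n) (g h : Coord n) :
    (proj (G.mul g h) : EuclideanSpace ℝ (Fin (n 0))) = proj g + proj h := by
  let := G.toGroup
  have := G.lieGroup
  exact map_mul_eq_add G.exp_coord
    (PiLp.proj 2 (fun i : Fin s => EuclideanSpace ℝ (Fin (n i))) (0 : Fin s) : _ →L[ℝ] _)
    (bracketAtOne_apply_zero G) g h

/-! ### The gauge near a horizontal vector -/

omit [NeZero s] in
/-- Multiplying bounded elements on both sides by elements of size `ρ ≤ 1` moves them by `O(ρ)`,
because the group operations are Lipschitz on compact sets. -/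
theorem exists_norm_conj_sub_le (G : CarnotGroup n) (R : ℝ) :
    ∃ K : ℝ, 0 < K ∧ ∀ ρ ≤ 1, ∀ p q y : Coord n, ‖p‖ ≤ ρ → ‖q‖ ≤ ρ → ‖y‖ ≤ R →
      ‖G.mul (G.inv p) (G.mul y q) - y‖ ≤ K * ρ := by
  let := G.toGroup
  have := G.lieGroup
  let Φ : Coord n × Coord n × Coord n → Coord n := fun z => z.1⁻¹ * (z.2.1 * z.2.2)
  have hΦ : ContDiff ℝ ∞ Φ :=
    contDiff_groupMul.comp ((contDiff_groupInv.comp contDiff_fst).prodMk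
      (contDiff_groupMul.comp contDiff_snd))
  let B : Set (Coord n × Coord n × Coord n) :=
    Metric.closedBall 0 1 ×ˢ Metric.closedBall 0 R ×ˢ Metric.closedBall 0 1
  have hB : IsCompact B := (isCompact_closedBall _ _).prod
    ((isCompact_closedBall _ _).prod (isCompact_closedBall _ _))
  obtain ⟨K, hK⟩ := LocallyLipschitzOn.exists_lipschitzOnWith_of_compact hB
    (hΦ.of_le (by simp) : ContDiff ℝ 1 Φ).locallyLipschitz.locallyLipschitzOn
  refine ⟨K + 1, by positivity, fun ρ hρ p q y hp hq hy => ?_⟩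
  have hρ0 : 0 ≤ ρ := (norm_nonneg p).trans hp
  have h := hK.norm_sub_le (x := (p, y, q)) (y := (0, y, 0))
    (by simp [B, hp.trans hρ, hq.trans hρ, hy]) (by simp [B, hy])
  have h0 : Φ (0, y, 0) = y := by
    have hone := one_eq_zero (E := Coord n) G.exp_coord
    simp only [Φ]
    rw [← hone]
    simp
  rw [h0] at h
  refine h.trans ?_
  have hn : ‖((p, y, q) : Coord n × Coord n × Coord n) - (0, y, 0)‖ ≤ ρ := by
    simp [Prod.norm_def, hp, hq]
  calc (K : ℝ) * _ ≤ K * ρ := by gcongr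
    _ ≤ (K + 1) * ρ := by nlinarith

/-- The positivity hypothesis excludes the junk value `sInf ∅ = 0`. -/
theorem norm_proj_le_mul_gauge {η : ℝ} (hη : 0 < η) {w : Coord n} (hw : 0 < gauge η w) :
    ‖(proj w : EuclideanSpace ℝ (Fin (n 0)))‖ ≤ η * gauge η w := by
  rw [← div_le_iff₀' hη]
  refine le_csInf ?_ ?_
  · by_contra h
    rw [Set.not_nonempty_iff_eq_empty] at h
    rw [gauge, h, Real.sInf_empty] at hw
    exact hw.false
  · rintro r ⟨hr, u, hu, rfl⟩
    rw [mem_closedBall_zero_iff] at hu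
    have h0 : proj (dilation r u) = r • u 0 := by simp [proj, dilation]
    rw [h0, norm_smul, Real.norm_of_nonneg hr.le, div_le_iff₀ hη]
    gcongr
    exact (PiLp.norm_apply_le u 0).trans hu

omit [NeZero s] in
theorem gauge_le_of_norm_dilation_le {η r : ℝ} (hr : 0 < r) {w : Coord n}
    (hw : ‖dilation r⁻¹ w‖ ≤ η) : gauge η w ≤ r := by
  refine csInf_le ⟨0, fun _ h => h.1.le⟩ ⟨hr, dilation r⁻¹ w, by simpa using hw, ?_⟩
  ext1 i
  simp [dilation, smul_smul, hr.ne']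

/-- The first-layer component of `w` is compared with `m` only up to `c`; every other component of
`w` is one of `w - horizontal m`, and is multiplied by at most `4 ^ s`. -/
theorem norm_dilation_inv_sq_le {r c : ℝ} (hr : 1 / 4 ≤ r) (w : Coord n)
    (m : EuclideanSpace ℝ (Fin (n 0))) (hc : ‖proj w‖ ^ 2 ≤ c ^ 2 + ‖proj w - m‖ ^ 2) :
    ‖dilation r⁻¹ w‖ ^ 2 ≤ c ^ 2 / r ^ 2 + 16 ^ s * ‖w - horizontal m‖ ^ 2 := by
  have hr0 : 0 < r := by linarith
  have hr4 : r⁻¹ ≤ 4 := by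
    rw [inv_le_comm₀ hr0 (by norm_num)]
    linarith
  have hcoef : ∀ i : Fin s, (r⁻¹ ^ ((i : ℕ) + 1)) ^ 2 ≤ (16 : ℝ) ^ s := by
    intro i
    calc (r⁻¹ ^ ((i : ℕ) + 1)) ^ 2 ≤ (4 ^ ((i : ℕ) + 1)) ^ 2 := by gcongr
      _ = (16 : ℝ) ^ ((i : ℕ) + 1) := by
        rw [← pow_mul, mul_comm, pow_mul]
        norm_num
      _ ≤ 16 ^ s := pow_le_pow_right₀ (by norm_num) (by omega)
  rw [PiLp.norm_sq_eq_of_L2, PiLp.norm_sq_eq_of_L2, Finset.mul_sum]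
  have hsum : c ^ 2 / r ^ 2 = ∑ i : Fin s, if i = 0 then c ^ 2 / r ^ 2 else 0 := by simp
  rw [hsum, ← Finset.sum_add_distrib]
  refine Finset.sum_le_sum fun i _ => ?_
  have hi : ‖(dilation r⁻¹ w) i‖ ^ 2 = (r⁻¹ ^ ((i : ℕ) + 1)) ^ 2 * ‖w i‖ ^ 2 := by
    have h : (dilation r⁻¹ w) i = r⁻¹ ^ ((i : ℕ) + 1) • w i := rfl
    rw [h, norm_smul, mul_pow, Real.norm_of_nonneg (by positivity)]
  rw [hi]
  split_ifs with h0
  · subst h0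
    have hm : (w - horizontal m : Coord n) 0 = proj w - m := by
      simp [horizontal, proj]
    rw [hm]
    have hk := hcoef 0
    have hz : (r⁻¹ ^ (((0 : Fin s) : ℕ) + 1)) ^ 2 = (r ^ 2)⁻¹ := by simp
    rw [hz] at hk ⊢
    calc (r ^ 2)⁻¹ * ‖w 0‖ ^ 2 ≤ (r ^ 2)⁻¹ * (c ^ 2 + ‖proj w - m‖ ^ 2) := by
          gcongr
          exact hc
      _ = c ^ 2 / r ^ 2 + (r ^ 2)⁻¹ * ‖proj w - m‖ ^ 2 := by ring
      _ ≤ _ := by gcongr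
  · have hm : (w - horizontal m : Coord n) i = w i := by
      rw [PiLp.sub_apply, horizontal, PiLp.single_eq_of_ne 2 h0, sub_zero]
    rw [hm, zero_add]
    gcongr
    exact hcoef i

/-- A point at distance `O(√u)` from a horizontal vector has gauge at most `(1 + u) c / η`, where
`c` is the size of its component along that vector. The error is linear in `u` since the deviation
is perpendicular to the horizontal direction, up to a change of `c`. -/
theorem gauge_le_of_near_horizontal {η c u : ℝ} (hη : 0 < η) (hc : 0 ≤ c) (hu : 0 ≤ u)
    (hu1 : u ≤ 1) {w : Coord n} (m : EuclideanSpace ℝ (Fin (n 0)))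
    (hwc : ‖proj w‖ ^ 2 ≤ c ^ 2 + ‖proj w - m‖ ^ 2)
    (hwm : 16 ^ s * ‖w - horizontal m‖ ^ 2 ≤ η ^ 2 * (u / 2)) (hw : 1 ≤ gauge η w) :
    gauge η w ≤ c / η * (1 + u) := by
  have hbound : ∀ r : ℝ, 1 / 4 ≤ r → c ^ 2 / r ^ 2 ≤ η ^ 2 * (1 - u / 2) → gauge η w ≤ r := by
    intro r hr h
    refine gauge_le_of_norm_dilation_le (by linarith) ?_
    refine le_of_sq_le_sq ?_ hη.le
    have := norm_dilation_inv_sq_le hr w m hwc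
    linarith
  -- If `c` were small, `w` would lie in the dilate of the ball by `1 / 2`, against `1 ≤ gauge η w`.
  have hcη : η / 4 ≤ c := by
    by_contra! hlt
    have h := hbound (1 / 2) (by norm_num) (by
      have h1 : c ^ 2 ≤ (η / 4) ^ 2 := by gcongr
      have h2 : η ^ 2 * (1 / 2) ≤ η ^ 2 * (1 - u / 2) := by
        gcongr
        linarith
      have h3 : c ^ 2 / (1 / 2) ^ 2 = 4 * c ^ 2 := by ring
      linarith [sq_nonneg η])
    linarith
  have hcpos : 0 < c := by linarith
  refine hbound _ ?_ ?_
  · have h1 : 1 / 4 ≤ c / η := by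
      rw [le_div_iff₀ hη]
      linarith
    nlinarith
  · have h1 : c ^ 2 / (c / η * (1 + u)) ^ 2 = η ^ 2 * (1 / (1 + u) ^ 2) := by
      field_simp
    rw [h1]
    gcongr
    rw [div_le_iff₀ (by positivity)]
    nlinarith [mul_nonneg hu (sub_nonneg.mpr hu1),
      mul_nonneg (mul_nonneg hu hu) (sub_nonneg.mpr hu1)]

/-! ### Projections onto horizontal lines -/

/-- The distance from `x` to its projection onto `U` is at most its distance to any `m ∈ U`. -/
theorem norm_sq_le_norm_orthogonalProjectionOnto_sq_add {V : Type*} [NormedAddCommGroup V]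
    [InnerProductSpace ℝ V] (U : Submodule ℝ V) [U.HasOrthogonalProjection] (x : V) {m : V}
    (hm : m ∈ U) : ‖x‖ ^ 2 ≤ ‖U.orthogonalProjectionOnto x‖ ^ 2 + ‖x - m‖ ^ 2 := by
  have h1 := Submodule.norm_sq_eq_add_norm_sq_projection x U
  have h2 := Submodule.norm_sq_eq_add_norm_sq_projection (x - m) U
  have h3 : Uᗮ.orthogonalProjectionOnto (x - m) = Uᗮ.orthogonalProjectionOnto x := by
    rw [map_sub, Submodule.orthogonalProjectionOnto_orthogonal_apply_eq_zero hm, sub_zero]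
  rw [h3] at h2
  nlinarith [sq_nonneg ‖U.orthogonalProjectionOnto (x - m)‖]

theorem norm_lineProj_sub (L : Set (Coord n)) [Nonempty L] (a b : Coord n) :
    ‖lineProj L a - lineProj L b‖ = ‖(affineSpan ℝ
      (proj '' L)).direction.orthogonalProjectionOnto (proj b - proj a)‖ := by
  rw [norm_sub_rev]
  unfold lineProj
  rw [EuclideanGeometry.orthogonalProjection_apply', EuclideanGeometry.orthogonalProjection_apply',
    vadd_eq_add, vadd_eq_add, add_sub_add_right_eq_sub, ← Submodule.coe_sub, ← map_sub,
    vsub_eq_sub, vsub_eq_sub, sub_sub_sub_cancel_right, Submodule.norm_coe]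

end CarnotGroup

/-- The norm on the first layer that makes `π` 1-Lipschitz and horizontal lines isometric to `ℝ`
is `v ↦ N_η(v, 0, …, 0) = ‖v‖ / η`. -/
theorem proposition3p3 {s : ℕ} [NeZero s] {n : Fin s → ℕ} (G : CarnotGroup n)
    (η : ℝ) (hη : G.IsHebischSikora η) (α : ℝ) (hα : 1 < α) :
    ∃ C > (0 : ℝ), ∃ ε₀ > (0 : ℝ),
      ∀ (L : Set (Carnot.Coord n)) [Nonempty L], G.IsHorizontalLine L →
      ∀ ε : ℝ, 0 ≤ ε → ε < ε₀ →
      ∀ a ∈ G.tube L (ε ^ s), ∀ b ∈ G.tube L (ε ^ s),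
        G.metric η a b ∈ Set.Icc 1 α →
        G.metric η a b / (1 + C * ε ^ (2 * s)) ≤
            ‖CarnotGroup.lineProj L a - CarnotGroup.lineProj L b‖ / η ∧
          ‖CarnotGroup.lineProj L a - CarnotGroup.lineProj L b‖ / η ≤ G.metric η a b := by
  have hη0 : 0 < η := hη.1
  obtain ⟨K, hK, hKle⟩ := G.exists_norm_conj_sub_le (η * α + 2)
  -- With `u = C ε^{2s}` this `C` gives `16^s (K ε^s)² = η² u / 2`.
  refine ⟨2 * 16 ^ s * K ^ 2 / η ^ 2, by positivity,
    min 1 (2 * 16 ^ s * K ^ 2 / η ^ 2)⁻¹, by positivity, ?_⟩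
  set C : ℝ := 2 * 16 ^ s * K ^ 2 / η ^ 2 with hC
  have hCpos : 0 < C := by positivity
  intro L _ hL ε hε0 hε a ha b hb hd
  have hs : s ≠ 0 := NeZero.ne s
  have hε1 : ε ≤ 1 := hε.le.trans (min_le_left _ _)
  have hρ1 : ε ^ s ≤ 1 := pow_le_one₀ hε0 hε1
  have hu : C * ε ^ (2 * s) ≤ 1 := by
    have h1 : ε ^ (2 * s) ≤ C⁻¹ :=
      (pow_le_of_le_one hε0 hε1 (by omega)).trans (hε.le.trans (min_le_right _ _))
    calc C * ε ^ (2 * s) ≤ C * C⁻¹ := by gcongr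
      _ = 1 := mul_inv_cancel₀ hCpos.ne'
  obtain ⟨x, v, -, rfl⟩ := hL
  obtain ⟨-, ⟨t, rfl⟩, p, hp, rfl⟩ := ha
  obtain ⟨-, ⟨t', rfl⟩, q, hq, rfl⟩ := hb
  rw [mem_closedBall_zero_iff] at hp hq
  beta_reduce at hd ⊢
  have hproj : ∀ m : EuclideanSpace ℝ (Fin (n 0)),
      CarnotGroup.proj (CarnotGroup.horizontal m : Carnot.Coord n) = m := by
    intro m
    simp [CarnotGroup.proj, CarnotGroup.horizontal]
  -- The horizontal vector `m` joins the two base points on the line, so that `a⁻¹ b = p⁻¹ m q`.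
  obtain ⟨m, hm⟩ : ∃ m, m = (t' - t) • v := ⟨_, rfl⟩
  have hprod : G.mul (G.inv (G.mul (G.mul x (CarnotGroup.horizontal (t • v))) p))
      (G.mul (G.mul x (CarnotGroup.horizontal (t' • v))) q) =
      G.mul (G.inv p) (G.mul (CarnotGroup.horizontal m) q) := by
    let := G.toGroup
    have hsmul : ∀ r : ℝ, (CarnotGroup.horizontal (r • v) : Carnot.Coord n) =
        r • CarnotGroup.horizontal v := by
      intro r
      simp [CarnotGroup.horizontal, ← PiLp.toLp_single, Pi.single_smul]
    have hmul : (CarnotGroup.horizontal (t' • v) : Carnot.Coord n) =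
        CarnotGroup.horizontal (t • v) * CarnotGroup.horizontal m := by
      rw [hm, hsmul, hsmul, hsmul, G.exp_coord, add_sub_cancel]
    change (x * CarnotGroup.horizontal (t • v) * p)⁻¹ *
      (x * CarnotGroup.horizontal (t' • v) * q) = p⁻¹ * (CarnotGroup.horizontal m * q)
    rw [hmul]
    group
  have hinv : ∀ g : Carnot.Coord n, CarnotGroup.proj (G.inv g) =
      -(CarnotGroup.proj g : EuclideanSpace ℝ (Fin (n 0))) := by
    intro g
    let := G.toGroup
    change CarnotGroup.proj (g⁻¹) = _
    rw [LieGroupOnVectorSpace.inv_eq_neg G.exp_coord]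
    rfl
  obtain ⟨w, hw⟩ : ∃ w, w = G.mul (G.inv p) (G.mul (CarnotGroup.horizontal m) q) := ⟨_, rfl⟩
  have hprojw : (CarnotGroup.proj w : EuclideanSpace ℝ (Fin (n 0))) =
      -CarnotGroup.proj p + (m + CarnotGroup.proj q) := by
    rw [hw, G.proj_mul, G.proj_mul, hinv, hproj]
  have hdiff : (CarnotGroup.proj (G.mul (G.mul x (CarnotGroup.horizontal (t' • v))) q) :
      EuclideanSpace ℝ (Fin (n 0))) -
      CarnotGroup.proj (G.mul (G.mul x (CarnotGroup.horizontal (t • v))) p) =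
      CarnotGroup.proj w := by
    rw [hw, ← hprod, G.proj_mul (G.inv _), hinv, sub_eq_neg_add]
  rw [CarnotGroup.metric, hprod, ← hw] at hd ⊢
  rw [CarnotGroup.norm_lineProj_sub, hdiff]
  set U := (affineSpan ℝ (CarnotGroup.proj '' G.horizontalLine x v :
    Set (EuclideanSpace ℝ (Fin (n 0))))).direction with hU
  obtain ⟨hd1, hdα⟩ := hd
  have hwη : ‖(CarnotGroup.proj w : EuclideanSpace ℝ (Fin (n 0)))‖ ≤
      η * CarnotGroup.gauge η w := CarnotGroup.norm_proj_le_mul_gauge hη0 (by linarith)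
  have hmU : m ∈ U := by
    have h : m = CarnotGroup.proj (G.mul x (CarnotGroup.horizontal (t' • v))) -
        CarnotGroup.proj (G.mul x (CarnotGroup.horizontal (t • v))) := by
      rw [G.proj_mul, G.proj_mul, hproj, hproj, hm]
      module
    rw [h, hU, direction_affineSpan]
    exact vsub_mem_vectorSpan ℝ ⟨_, ⟨t', rfl⟩, rfl⟩ ⟨_, ⟨t, rfl⟩, rfl⟩
  have hmnorm : ‖(CarnotGroup.horizontal m : Carnot.Coord n)‖ ≤ η * α + 2 := by
    have h1 : ‖(CarnotGroup.horizontal m : Carnot.Coord n)‖ = ‖m‖ :=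
      PiLp.norm_single 2 _ _ _
    have h2 : m = CarnotGroup.proj w + CarnotGroup.proj p - CarnotGroup.proj q := by
      rw [hprojw]
      abel
    have h3 : ‖(CarnotGroup.proj p : EuclideanSpace ℝ (Fin (n 0)))‖ ≤ 1 :=
      (PiLp.norm_apply_le p 0).trans (hp.trans hρ1)
    have h4 : ‖(CarnotGroup.proj q : EuclideanSpace ℝ (Fin (n 0)))‖ ≤ 1 :=
      (PiLp.norm_apply_le q 0).trans (hq.trans hρ1)
    have h5 : η * CarnotGroup.gauge η w ≤ η * α := by gcongr
    rw [h1, h2]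
    have h6 := norm_sub_le (CarnotGroup.proj w + CarnotGroup.proj p :
      EuclideanSpace ℝ (Fin (n 0))) (CarnotGroup.proj q)
    have h7 := norm_add_le (CarnotGroup.proj w : EuclideanSpace ℝ (Fin (n 0)))
      (CarnotGroup.proj p)
    linarith
  have hnear : ‖w - CarnotGroup.horizontal m‖ ≤ K * ε ^ s := by
    rw [hw]
    exact hKle _ hρ1 p q _ hp hq hmnorm
  refine ⟨?_, ?_⟩
  · rw [div_le_iff₀ (by positivity)]
    refine CarnotGroup.gauge_le_of_near_horizontal hη0 (norm_nonneg _) (by positivity) hu m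
      (CarnotGroup.norm_sq_le_norm_orthogonalProjectionOnto_sq_add U _ hmU) ?_ hd1
    calc (16 : ℝ) ^ s * ‖w - CarnotGroup.horizontal m‖ ^ 2 ≤ 16 ^ s * (K * ε ^ s) ^ 2 := by gcongr
      _ = η ^ 2 * (C * ε ^ (2 * s) / 2) := by
        rw [hC]
        field_simp
        ring
  · rw [div_le_iff₀' hη0]
    exact (U.norm_orthogonalProjectionOnto_apply_le _).trans hwη
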